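/- **Definitions.** A *precontact algebra* $\underline B=(B,C)$ is a Boolean algebra $B=(B,0,1,+,\cdot,{}^*)$ (the case $0=1$ is allowed) with a binary relation $C$ such that $aCb$ implies $a\neq0\neq b$; $aC(b+c)$ iff $aCb$ or $aCc$; $(a+b)Cc$ iff $aCc$ or $bCc$. Write $a\ll_C b$ iff not $aCb^*$, and $aC^{\#}b$ iff $aCb$ or $bCa$ or $a\cdot b\neq 0$. The axioms are: (Cref) $a\ne0\Rightarrow aCa$; (Csym) $aCb\Rightarrow bCa$; (Ctr) $a\ll_C c\Rightarrow\exists b\,(a\ll_C b\ll_C c)$; (Ccon) $a\neq0,1\Rightarrow aCa^*$ or $a^*Ca$. $(B,C)$ is a *contact algebra* if (Cref) and (Csym) hold, *connected* if (Ccon) holds, and *complete* if $B$ is complete. A *PCA-isomorphism* $(B,C)\to(B_1,C_1)$ is a Boolean isomorphism $\varphi$ with $aCb\iff\varphi(a)C_1\varphi(b)$; between contact algebras it is called a *CA-isomorphism*. A *clan* of $(B,C)$ is a non-empty up-closed set $\Gamma\subseteq B$ with $0\notin\Gamma$, such that $a+b\in\Gamma$ implies $a\in\Gamma$ or $b\in\Gamma$,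 and $a,b\in\Gamma$ implies $aC^{\#}b$. Every ultrafilter of $B$ is a clan. For a dense subspace $X_0$ of a topological space $X$ put $RC(X,X_0)=\{\mathrm{cl}_X(A)\mid A\in CO(X_0)\}$, where $CO(X_0)$ is the Boolean algebra of clopen subsets of $X_0$. It is a Boolean subalgebra of the Boolean algebra $RC(X)$ of regular closed subsets of $X$ (with $F+G=F\cup G$, $F\cdot G=\mathrm{cl}(\mathrm{int}(F\cap G))$, $F^*=\mathrm{cl}(X\setminus F)$). On it let $F\,C_{(X,X_0)}\,G$ iff $F\cap G\ne\emptyset$; for a relation $R$ on $X_0$ and $F,G\in CO(X_0)$, let $F\,C_R\,G$ iff $xRy$ for some $x\in F$, $y\in G$. A *2-precontact space* $\underline X=(X,X_0,R)$ consists of a $T_0$-space $X$, a dense subspace $X_0$ which is compact, Hausdorff and zero-dimensional, and a closed binary relation $R$ on $X_0$, such that $RC(X,X_0)$ is a closed base of $X$; $\mathrm{cl}_X(F)\cap\mathrm{cl}_X(G)\neq\emptyset$ implies $F(C_R)^{\#}G$ for all $F,G\in CO(X_0)$; and every clan $\Gamma$ of $(CO(X_0),C_R)$ is of the form $\{F\in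 CO(X_0)\mid x\in\mathrm{cl}_X(F)\}$ for some $x\in X$. The empty space is allowed. $\underline X$ is *reflexive, symmetric, transitive* if $R$ is, and *connected* if $X$ is not the union of two disjoint non-empty open sets (so the empty space is connected). A *PCS-isomorphism* $(X,X_0,R)\to(\widehat X,\widehat X_0,\widehat R)$ is a homeomorphism $f:X\to\widehat X$ with $f(X_0)=\widehat X_0$ and $xRy\iff f(x)\widehat Rf(y)$ for all $x,y\in X_0$. The *canonical precontact algebra* of $\underline X$ is $\underline B(\underline X)=(RC(X,X_0),C_{\underline X})$, where $F\,C_{\underline X}\,G$ iff $xRy$ for some $x\in F\cap X_0$, $y\in G\cap X_0$. The *canonical 2-precontact space* of $\underline B=(B,C)$ is $\underline X(\underline B)=(X,X_0,R)$, where $X$ is the set of clans of $\underline B$ with the topology having the sets $g_B(a)=\{\Gamma\in X\mid a\in\Gamma\}$, $a\in B$, as a closed base, $X_0$ is the subspace of ultrafilters of $B$, and $U\,R\,V$ iff $U\times V\subseteq C$. **Theorem (Representation theorem for precontact algebras).** (a) Let $\underline B=(B,C)$ be a precontact algebra and $\underline X(\underline B)=(X,X_0,R)$ its canonical 2-precontact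 space. Then $g_B$ is a PCA-isomorphism from $(B,C)$ onto $(RC(X,X_0),C_{\underline X(\underline B)})$. The pairs $(B,C^{\#})$ and $(RC(X,X_0),C_{(X,X_0)})$ are contact algebras, and the same map $g_B$ is a CA-isomorphism from the first onto the second. The sets $RC(X)$ and $RC(X,X_0)$ coincide iff $\underline B$ is complete. $\underline B$ satisfies (Cref) (resp. (Csym); (Ctr)) iff $\underline X(\underline B)$ is reflexive (resp. symmetric; transitive). $\underline B$ is connected iff $\underline X(\underline B)$ is connected. Finally, $0\ne1$ in $B$ iff $X_0\ne\emptyset$. (b) The assignments $[\underline B]\mapsto[\underline X(\underline B)]$ and $[\underline X]\mapsto[\underline B(\underline X)]$ are well defined and are mutually inverse bijections between the class of PCA-isomorphism classes of precontact algebras and the class of PCS-isomorphism classes of 2-precontact spaces. They restrict to a bijection between the classes of connected precontact algebras and the classes of connected 2-precontact spaces, and to a bijection between the classes of precontact algebras with $0\neq1$ and the classes of 2-precontact spaces with $X_0\ne\emptyset$. -/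

import Mathlib

open Set TopologicalSpace

universe u

namespace Precontact

/-! ### Precontact relations on a Boolean algebra -/

section Relations

variable {B : Type u} [BooleanAlgebra B]

/-- Precontact relation on a Boolean algebra (which may be degenerate, i.e. `0 = 1` is allowed). -/
structure IsPrecontact (C : B → B → Prop) : Prop where
  ne_bot : ∀ a b, C a b → a ≠ ⊥ ∧ b ≠ ⊥
  sup_right : ∀ a b c, C a (b ⊔ c) ↔ C a b ∨ C a c
  sup_left : ∀ a b c, C (a ⊔ b) c ↔ C a c ∨ C b c

/-- Axiom (Cref). -/
def AxRef (C : B → B → Prop) : Prop := ∀ a, a ≠ ⊥ → C a a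

/-- Axiom (Csym). -/
def AxSym (C : B → B → Prop) : Prop := ∀ a b, C a b → C b a

/-- Non-tangential inclusion `a ≪_C b`. -/
def NonTang (C : B → B → Prop) (a b : B) : Prop := ¬ C a bᶜ

/-- Axiom (Ctr). -/
def AxTr (C : B → B → Prop) : Prop :=
  ∀ a c, NonTang C a c → ∃ b, NonTang C a b ∧ NonTang C b c

/-- Axiom (Ccon). -/
def AxCon (C : B → B → Prop) : Prop := ∀ a, a ≠ ⊥ → a ≠ ⊤ → C a aᶜ ∨ C aᶜ a

/-- The relation `C^#`. -/
def sharpRel (C : B → B → Prop) (a b : B) : Prop := C a b ∨ C b a ∨ a ⊓ b ≠ ⊥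

/-- Clans of `(B, C)`. -/
structure IsClan (C : B → B → Prop) (Γ : Set B) : Prop where
  nonempty : Γ.Nonempty
  bot_notMem : ⊥ ∉ Γ
  mem_of_le : ∀ a b, a ∈ Γ → a ≤ b → b ∈ Γ
  sup_mem : ∀ a b, a ⊔ b ∈ Γ → a ∈ Γ ∨ b ∈ Γ
  sharp : ∀ a b, a ∈ Γ → b ∈ Γ → sharpRel C a b

/-- Ultrafilters of a Boolean algebra: proper filters containing `a` or `a*` for every `a`. -/
structure IsUlt (U : Set B) : Prop where
  top_mem : ⊤ ∈ U
  bot_notMem : ⊥ ∉ U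
  mem_of_le : ∀ a b, a ∈ U → a ≤ b → b ∈ U
  inf_mem : ∀ a b, a ∈ U → b ∈ U → a ⊓ b ∈ U
  mem_or_compl_mem : ∀ a, a ∈ U ∨ aᶜ ∈ U

/-- The relation `C_R` on the clopen subsets of a space with a binary relation `R`. -/
def clopenRel {W : Type u} [TopologicalSpace W] (R : W → W → Prop) (F G : Clopens W) : Prop :=
  ∃ x ∈ F, ∃ y ∈ G, R x y

theorem IsPrecontact.sharpRel {C : B → B → Prop} (h : IsPrecontact C) :
    IsPrecontact (sharpRel C) where
  ne_bot := by
    rintro a b (h1 | h1 | h1)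
    · exact h.ne_bot _ _ h1
    · exact (h.ne_bot _ _ h1).symm
    · constructor <;> rintro rfl <;> simp at h1
  sup_right a b c := by
    unfold Precontact.sharpRel
    rw [h.sup_right, h.sup_left, inf_sup_left, Ne, sup_eq_bot_iff]
    tauto
  sup_left a b c := by
    unfold Precontact.sharpRel
    rw [h.sup_right, h.sup_left, inf_sup_right, Ne, sup_eq_bot_iff]
    tauto

theorem IsUlt.not_mem_and_compl {U : Set B} (h : IsUlt U) (a : B) (h1 : a ∈ U) : aᶜ ∉ U :=
  fun h2 => h.bot_notMem (by simpa using h.inf_mem _ _ h1 h2)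

theorem IsUlt.mem_or {U : Set B} (h : IsUlt U) (a b : B) (hab : a ⊔ b ∈ U) : a ∈ U ∨ b ∈ U := by
  by_contra! hn
  have ha := (h.mem_or_compl_mem a).resolve_left hn.1
  have hb := (h.mem_or_compl_mem b).resolve_left hn.2
  have h1 := h.inf_mem _ _ ha hb
  rw [← compl_sup] at h1
  exact h.not_mem_and_compl _ hab h1

theorem IsUlt.isClan {U : Set B} (h : IsUlt U) (C : B → B → Prop) : IsClan C U where
  nonempty := ⟨_, h.top_mem⟩
  bot_notMem := h.bot_notMem
  mem_of_le := h.mem_of_le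
  sup_mem := h.mem_or
  sharp a b ha hb := by
    refine Or.inr (Or.inr fun h0 => h.bot_notMem ?_)
    rw [← h0]; exact h.inf_mem _ _ ha hb

/-- A grill containing `a` contains an ultrafilter containing `a`. -/
theorem exists_ult {G : Set B} (h0 : ⊥ ∉ G) (hle : ∀ a b, a ∈ G → a ≤ b → b ∈ G)
    (hsup : ∀ a b, a ⊔ b ∈ G → a ∈ G ∨ b ∈ G) {a : B} (ha : a ∈ G) :
    ∃ U : Set B, IsUlt U ∧ a ∈ U ∧ U ⊆ G := by
  let I : Order.Ideal B :=
    { carrier := Gᶜ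
      lower' := fun x y hyx hx hy => hx (hle _ _ hy hyx)
      nonempty' := ⟨⊥, h0⟩
      directed' := fun x hx y hy =>
        ⟨x ⊔ y, fun h => (hsup _ _ h).elim hx hy, le_sup_left, le_sup_right⟩ }
  have hdis : Disjoint (Order.PFilter.principal a : Set B) (I : Set B) := by
    rw [Set.disjoint_left]
    intro x hx hxI
    exact hxI (hle _ _ ha (Order.PFilter.mem_principal.1 hx))
  obtain ⟨J, hJ, hIJ, hFJ⟩ := DistribLattice.prime_ideal_of_disjoint_filter_ideal hdis
  have haJ : a ∉ J := fun h =>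
    Set.disjoint_left.1 hFJ (Order.PFilter.mem_principal.2 le_rfl) h
  refine ⟨(J : Set B)ᶜ, ?_, haJ, ?_⟩
  · have htop : (⊤ : B) ∉ J := fun h => haJ (J.lower le_top h)
    refine ⟨htop, fun h => h J.bot_mem, fun x y hx hxy hy => hx (J.lower hxy hy), ?_, ?_⟩
    · intro x y hx hy hxy
      exact (hJ.mem_or_mem hxy).elim hx hy
    · intro x
      by_contra! hn
      have h1 : x ∈ J := by simpa using hn.1
      have h2 : xᶜ ∈ J := by simpa using hn.2
      exact htop (by simpa using Order.Ideal.sup_mem h1 h2)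
  · intro x hx
    by_contra hxG
    exact hx (hIJ hxG)

theorem exists_ult_of_ne_bot {a : B} (ha : a ≠ ⊥) : ∃ U : Set B, IsUlt U ∧ a ∈ U := by
  obtain ⟨U, hU, haU, -⟩ := exists_ult (G := {x : B | x ≠ ⊥}) (by simp)
    (fun x y hx hxy hy => hx (le_bot_iff.1 (hy ▸ hxy)))
    (fun x y h => by
      by_contra! hn
      simp only [mem_ofPred_eq, not_not] at hn
      exact h (by simp [hn.1, hn.2])) ha
  exact ⟨U, hU, haU⟩

theorem IsPrecontact.mono {C : B → B → Prop} (h : IsPrecontact C) {a b c d : B}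
    (hac : a ≤ c) (hbd : b ≤ d) (hab : C a b) : C c d := by
  rw [← sup_eq_right.2 hac, ← sup_eq_right.2 hbd]
  exact (h.sup_left _ _ _).2 (Or.inl ((h.sup_right _ _ _).2 (Or.inl hab)))

theorem IsPrecontact.exists_ult_pair {C : B → B → Prop} (h : IsPrecontact C) {a b : B}
    (hab : C a b) : ∃ U V : Set B, IsUlt U ∧ IsUlt V ∧ a ∈ U ∧ b ∈ V ∧
      ∀ x ∈ U, ∀ y ∈ V, C x y := by
  obtain ⟨U, hU, haU, hUC⟩ := exists_ult (G := {x : B | C x b})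
    (fun h0 => (h.ne_bot _ _ h0).1 rfl) (fun x y hx hxy => h.mono hxy le_rfl hx)
    (fun x y hxy => (h.sup_left _ _ _).1 hxy) hab
  obtain ⟨V, hV, hbV, hVC⟩ := exists_ult (G := {y : B | ∀ x ∈ U, C x y})
    (fun h0 => (h.ne_bot _ _ (h0 ⊤ hU.top_mem)).2 rfl)
    (fun x y hx hxy z hz => h.mono le_rfl hxy (hx z hz))
    (fun x y hxy => by
      by_contra! hn
      simp only [mem_ofPred_eq, not_forall] at hn
      obtain ⟨⟨p, hp, hp'⟩, q, hq, hq'⟩ := hn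
      rcases (h.sup_right _ _ _).1 (hxy _ (hU.inf_mem _ _ hp hq)) with h1 | h1
      · exact hp' (h.mono inf_le_left le_rfl h1)
      · exact hq' (h.mono inf_le_right le_rfl h1)) hUC
  exact ⟨U, V, hU, hV, haU, hbV, fun x hx y hy => hVC hy x hx⟩

end Relations

/-! ### Precontact algebras and their isomorphisms -/

/-- A precontact algebra `(B, C)`. -/
structure PrecontactAlgebra : Type (u + 1) where
  carrier : Type u
  [boolean : BooleanAlgebra carrier]
  C : carrier → carrier → Prop
  isPrecontact : IsPrecontact C

attribute [instance] PrecontactAlgebra.boolean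

instance : CoeSort PrecontactAlgebra.{u} (Type u) := ⟨PrecontactAlgebra.carrier⟩

namespace PrecontactAlgebra

/-- `(B, C)` is a contact algebra. -/
def IsContact (B : PrecontactAlgebra.{u}) : Prop := AxRef B.C ∧ AxSym B.C

/-- `(B, C)` is connected. -/
def IsConnected (B : PrecontactAlgebra.{u}) : Prop := AxCon B.C

/-- `(B, C)` is complete: every subset of the Boolean algebra `B` has a join. -/
def IsComplete (B : PrecontactAlgebra.{u}) : Prop := ∀ S : Set B, ∃ a : B, IsLUB S a

/-- The algebra `(B, C^#)`. -/
def sharp (B : PrecontactAlgebra.{u}) : PrecontactAlgebra.{u} where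
  carrier := B
  C := sharpRel B.C
  isPrecontact := B.isPrecontact.sharpRel

/-- PCA-isomorphisms: Boolean isomorphisms (equivalently, order isomorphisms of the Boolean
algebras) which preserve and reflect the precontact relation. A CA-isomorphism is a
PCA-isomorphism between contact algebras. -/
structure Iso (A B : PrecontactAlgebra.{u}) where
  toOrderIso : A ≃o B
  map_rel : ∀ a b : A, A.C a b ↔ B.C (toOrderIso a) (toOrderIso b)

instance setoid : Setoid PrecontactAlgebra.{u} where
  r A B := Nonempty (Iso A B)
  iseqv :=
    { refl := fun A => ⟨⟨OrderIso.refl A, fun _ _ => Iff.rfl⟩⟩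
      symm := fun {A B} ⟨f⟩ => ⟨⟨f.toOrderIso.symm, fun a b => by
        have := f.map_rel (f.toOrderIso.symm a) (f.toOrderIso.symm b)
        simp only [OrderIso.apply_symm_apply] at this
        exact this.symm⟩⟩
      trans := fun ⟨f⟩ ⟨g⟩ => ⟨⟨f.toOrderIso.trans g.toOrderIso, fun a b =>
        (f.map_rel a b).trans (g.map_rel _ _)⟩⟩ }

end PrecontactAlgebra

/-! ### Regular closed sets and topological pairs -/

section RegularClosed

variable {X : Type u} [TopologicalSpace X]

variable (X) in
/-- The regular closed subsets of `X`. -/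
structure RC where
  carrier : Set X
  closure_interior' : closure (interior carrier) = carrier

namespace RC

instance : SetLike (RC X) X where
  coe := RC.carrier
  coe_injective F G h := by cases F; cases G; congr

theorem closure_interior (F : RC X) : closure (interior (F : Set X)) = F := F.closure_interior'

theorem isClosed (F : RC X) : IsClosed (F : Set X) := by
  rw [← F.closure_interior]; exact isClosed_closure

theorem closure_interior_of_isOpen {U : Set X} (hU : IsOpen U) :
    closure (interior (closure U)) = closure U :=
  (closure_minimal interior_subset isClosed_closure).antisymm
    (closure_mono hU.subset_interior_closure)

/-- `RC X` is ordered by inclusion. -/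
instance : PartialOrder (RC X) := .ofSetLike (RC X) X

/-- `F + G = F ∪ G`. -/
instance : Max (RC X) := ⟨fun F G => ⟨(F : Set X) ∪ G,
  (closure_minimal interior_subset (F.isClosed.union G.isClosed)).antisymm (union_subset
    (F.closure_interior.symm.subset.trans (closure_mono (interior_mono subset_union_left)))
    (G.closure_interior.symm.subset.trans (closure_mono (interior_mono subset_union_right))))⟩⟩

/-- `F . G = cl (int (F ∩ G))`. -/
instance : Min (RC X) := ⟨fun F G => ⟨closure (interior ((F : Set X) ∩ G)),
  closure_interior_of_isOpen isOpen_interior⟩⟩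

/-- `F* = cl (X \ F)`. -/
instance : Compl (RC X) := ⟨fun F => ⟨closure (F : Set X)ᶜ,
  closure_interior_of_isOpen F.isClosed.isOpen_compl⟩⟩

instance : Bot (RC X) := ⟨⟨∅, by simp⟩⟩

instance : Top (RC X) := ⟨⟨univ, by simp⟩⟩

theorem coe_sup (F G : RC X) : ((F ⊔ G : RC X) : Set X) = (F : Set X) ∪ G := rfl
theorem coe_inf (F G : RC X) : ((F ⊓ G : RC X) : Set X) = closure (interior ((F : Set X) ∩ G)) := rfl
theorem coe_compl (F : RC X) : ((Fᶜ : RC X) : Set X) = closure (F : Set X)ᶜ := rfl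
theorem coe_bot : ((⊥ : RC X) : Set X) = ∅ := rfl
theorem coe_top : ((⊤ : RC X) : Set X) = univ := rfl

theorem coe_inf_subset (F G : RC X) : ((F ⊓ G : RC X) : Set X) ⊆ (F : Set X) ∩ G :=
  closure_minimal interior_subset (F.isClosed.inter G.isClosed)

instance : Lattice (RC X) where
  sup := (· ⊔ ·)
  inf := (· ⊓ ·)
  le_sup_left F G := show (F : Set X) ⊆ F ∪ G from subset_union_left
  le_sup_right F G := show (G : Set X) ⊆ F ∪ G from subset_union_right
  sup_le F G H h1 h2 := show (F : Set X) ∪ G ⊆ H from union_subset h1 h2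
  inf_le_left F G := (coe_inf_subset F G).trans inter_subset_left
  inf_le_right F G := (coe_inf_subset F G).trans inter_subset_right
  le_inf F G H h1 h2 := by
    change (F : Set X) ⊆ closure (interior (G ∩ H))
    rw [← F.closure_interior]
    exact closure_mono (interior_mono (subset_inter h1 h2))

/-- The Boolean algebra of regular closed sets. -/
instance : BooleanAlgebra (RC X) where
  le_sup_inf F G H := by
    change closure (interior (((F : Set X) ∪ G) ∩ (F ∪ H))) ⊆ F ∪ closure (interior (G ∩ H))
    rw [← union_inter_distrib_left]
    refine closure_minimal (fun x hx => ?_) (F.isClosed.union isClosed_closure)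
    by_cases hxF : x ∈ (F : Set X)
    · exact Or.inl hxF
    · refine Or.inr (subset_closure (mem_interior.2
        ⟨interior ((F : Set X) ∪ (G ∩ H)) \ F, ?_, isOpen_interior.sdiff F.isClosed, hx, hxF⟩))
      rintro y ⟨hy, hyF⟩
      exact (interior_subset hy).resolve_left hyF
  inf_compl_le_bot F := by
    change closure (interior ((F : Set X) ∩ closure (F : Set X)ᶜ)) ⊆ ∅
    have h : (F : Set X) ∩ closure (F : Set X)ᶜ = frontier (F : Set X) := by
      rw [frontier_eq_closure_inter_closure, F.isClosed.closure_eq]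
    rw [h, interior_frontier F.isClosed, closure_empty]
  top_le_sup_compl F := by
    intro x _
    by_cases hx : x ∈ (F : Set X)
    · exact Or.inl hx
    · exact Or.inr (subset_closure hx)
  le_top F := show (F : Set X) ⊆ univ from subset_univ _
  bot_le F := show (∅ : Set X) ⊆ F from empty_subset _

end RC

/-- The closure in `X` of a clopen subset of the subspace `X₀`. -/
def clX {X₀ : Set X} (A : Clopens X₀) : Set X := closure (Subtype.val '' (A : Set X₀))

/-- `RC(X, X₀)` as a family of subsets of `X`. -/
def rcPairSet (X₀ : Set X) : Set (Set X) := {F | ∃ A : Clopens X₀, F = clX A}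

theorem clX_sup {X₀ : Set X} (A A' : Clopens X₀) : clX (A ⊔ A') = clX A ∪ clX A' := by
  simp [clX, image_union]

theorem compl_clX_inter {X₀ : Set X} (A : Clopens X₀) :
    (clX A)ᶜ ∩ X₀ = Subtype.val '' ((Aᶜ : Clopens X₀) : Set X₀) := by
  ext x
  constructor
  · rintro ⟨hx, hx0⟩
    exact ⟨⟨x, hx0⟩, fun h => hx (subset_closure ⟨_, h, rfl⟩), rfl⟩
  · rintro ⟨y, hy, rfl⟩
    refine ⟨fun h => hy ?_, y.2⟩
    have : y ∈ closure (A : Set X₀) := by rwa [closure_subtype]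
    rwa [A.isClosed.closure_eq] at this

theorem closure_compl_clX {X₀ : Set X} (hd : Dense X₀) (A : Clopens X₀) :
    closure (clX A)ᶜ = clX Aᶜ := by
  have hU : IsOpen (clX A)ᶜ := isClosed_closure.isOpen_compl
  have h : closure ((clX A)ᶜ ∩ X₀) = clX Aᶜ := by rw [compl_clX_inter]; rfl
  rw [← h]
  exact (closure_minimal (hd.open_subset_closure_inter hU) isClosed_closure).antisymm
    (closure_mono inter_subset_left)

theorem clX_regular {X₀ : Set X} (hd : Dense X₀) (A : Clopens X₀) :
    closure (interior (clX A)) = clX A := by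
  have h := closure_compl_clX hd Aᶜ
  rw [compl_compl] at h
  rw [← h]
  exact RC.closure_interior_of_isOpen isClosed_closure.isOpen_compl

/-- `RC(X, X₀)` as a Boolean subalgebra of `RC(X)`, for a topological pair `(X, X₀)`, i.e. for
a dense subspace `X₀` of `X`. -/
def rcPair (X₀ : Set X) (hd : Dense X₀) : BooleanSubalgebra (RC X) :=
  have hsup : ∀ F G : RC X, (F : Set X) ∈ rcPairSet X₀ → (G : Set X) ∈ rcPairSet X₀ →
      ((F ⊔ G : RC X) : Set X) ∈ rcPairSet X₀ := by
    rintro F G ⟨A, hA⟩ ⟨A', hA'⟩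
    exact ⟨A ⊔ A', by rw [clX_sup, RC.coe_sup, hA, hA']⟩
  have hcompl : ∀ F : RC X, (F : Set X) ∈ rcPairSet X₀ →
      ((Fᶜ : RC X) : Set X) ∈ rcPairSet X₀ := by
    rintro F ⟨A, hA⟩
    exact ⟨Aᶜ, by rw [RC.coe_compl, hA, closure_compl_clX hd]⟩
  { carrier := {F : RC X | (F : Set X) ∈ rcPairSet X₀}
    supClosed' := fun F hF G hG => hsup F G hF hG
    infClosed' := fun F hF G hG => by
      have h := hcompl _ (hsup _ _ (hcompl F hF) (hcompl G hG))
      rwa [compl_sup, compl_compl, compl_compl] at h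
    compl_mem' := fun {F} hF => hcompl F hF
    bot_mem' := ⟨⊥, by simp [clX, RC.coe_bot]⟩ }

/-- The contact algebra `(RC(X, X₀), C_(X, X₀))`, with `F C_(X, X₀) G` iff `F ∩ G ≠ ∅`. -/
def pairContactAlgebra (X₀ : Set X) (hd : Dense X₀) : PrecontactAlgebra.{u} where
  carrier := rcPair X₀ hd
  C F G := (((F : RC X) : Set X) ∩ ((G : RC X) : Set X)).Nonempty
  isPrecontact :=
    { ne_bot := by
        rintro F G ⟨x, hx, hy⟩
        constructor
        · rintro rfl; exact hx
        · rintro rfl; exact hy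
      sup_right := fun F G H => by
        change (((F : RC X) : Set X) ∩ (((G : RC X) : Set X) ∪ ((H : RC X) : Set X))).Nonempty ↔ _
        rw [inter_union_distrib_left, union_nonempty]
      sup_left := fun F G H => by
        change ((((F : RC X) : Set X) ∪ ((G : RC X) : Set X)) ∩ ((H : RC X) : Set X)).Nonempty ↔ _
        rw [union_inter_distrib_right, union_nonempty] }

end RegularClosed

/-! ### 2-precontact spaces -/

/-- `(W, R)` is a Stone adjacency space: `W` is compact, Hausdorff and zero-dimensional, and `R`
is a closed relation on `W`. (The empty space is allowed; it belongs to the degenerate Boolean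
algebra.) -/
structure IsStoneAdjacency {W : Type u} [TopologicalSpace W] (R : W → W → Prop) : Prop where
  compact : CompactSpace W
  t2 : T2Space W
  zeroDim : IsTopologicalBasis {U : Set W | IsClopen U}
  isClosed_rel : IsClosed {p : W × W | R p.1 p.2}

/-- `𝓑` is a closed base of `X`, i.e. the complements of its members form an open base. -/
def IsClosedBase {X : Type u} [TopologicalSpace X] (𝓑 : Set (Set X)) : Prop :=
  IsTopologicalBasis {U : Set X | Uᶜ ∈ 𝓑}

/-- A 2-precontact space `(X, X₀, R)`. -/
structure TwoPrecontactSpace : Type (u + 1) where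
  X : Type u
  [top : TopologicalSpace X]
  X₀ : Set X
  R : X₀ → X₀ → Prop
  dense : Dense X₀
  t0 : T0Space X
  stone : IsStoneAdjacency R
  closedBase : IsClosedBase (rcPairSet X₀)
  sharp_of_inter : ∀ F G : Clopens X₀, (clX F ∩ clX G).Nonempty → sharpRel (clopenRel R) F G
  exists_point : ∀ Γ : Set (Clopens X₀), IsClan (clopenRel R) Γ → ∃ x : X, Γ = {F | x ∈ clX F}

attribute [instance] TwoPrecontactSpace.top

namespace TwoPrecontactSpace

/-- The space `X` is connected, i.e. not a union of two disjoint non-empty open sets. (The empty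
space counts as connected.) -/
def IsConnected (S : TwoPrecontactSpace.{u}) : Prop := PreconnectedSpace S.X

def IsReflexive (S : TwoPrecontactSpace.{u}) : Prop := ∀ x, S.R x x

def IsSymmetric (S : TwoPrecontactSpace.{u}) : Prop := ∀ x y, S.R x y → S.R y x

def IsTransitive (S : TwoPrecontactSpace.{u}) : Prop := ∀ x y z, S.R x y → S.R y z → S.R x z

/-- PCS-isomorphisms. -/
structure Iso (S T : TwoPrecontactSpace.{u}) where
  toHomeomorph : S.X ≃ₜ T.X
  image_eq : toHomeomorph '' S.X₀ = T.X₀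
  map_rel : ∀ x y : S.X₀, S.R x y ↔
    T.R ⟨toHomeomorph x, image_eq.subset (mem_image_of_mem toHomeomorph x.2)⟩
      ⟨toHomeomorph y, image_eq.subset (mem_image_of_mem toHomeomorph y.2)⟩

instance setoid : Setoid TwoPrecontactSpace.{u} where
  r S T := Nonempty (Iso S T)
  iseqv :=
    { refl := fun S => ⟨⟨Homeomorph.refl S.X, by simp, fun _ _ => Iff.rfl⟩⟩
      symm := fun {S T} ⟨f⟩ => by
        have hi : f.toHomeomorph '' S.X₀ = T.X₀ := f.image_eq
        have hj : f.toHomeomorph.symm '' T.X₀ = S.X₀ := by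
          rw [← hi, ← image_comp]; simp
        refine ⟨⟨f.toHomeomorph.symm, hj, fun x y => ?_⟩⟩
        have h := f.map_rel ⟨f.toHomeomorph.symm x, hj.subset (mem_image_of_mem _ x.2)⟩
          ⟨f.toHomeomorph.symm y, hj.subset (mem_image_of_mem _ y.2)⟩
        refine Iff.trans (iff_of_eq ?_) h.symm
        congr 1 <;> exact Subtype.ext (f.toHomeomorph.apply_symm_apply _).symm
      trans := fun {S T V} ⟨f⟩ ⟨g⟩ => by
        refine ⟨⟨f.toHomeomorph.trans g.toHomeomorph, ?_, fun x y =>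
          (f.map_rel x y).trans (g.map_rel _ _)⟩⟩
        have hf := f.image_eq
        have hg := g.image_eq
        rw [← hg, ← hf, ← image_comp]
        rfl }

/-- An element of `RC(X, X₀)` as a subset of `X`. -/
def region (S : TwoPrecontactSpace.{u}) (F : rcPair S.X₀ S.dense) : Set S.X := (F : RC S.X)

/-- The contact algebra `(RC(X, X₀), C_(X, X₀))` of the topological pair `(X, X₀)`. -/
def contactAlgebra (S : TwoPrecontactSpace.{u}) : PrecontactAlgebra.{u} :=
  pairContactAlgebra S.X₀ S.dense

/-- The canonical precontact algebra `(RC(X, X₀), C)` of `(X, X₀, R)`, where `F C G` iff `x R y`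
for some `x ∈ F ∩ X₀` and `y ∈ G ∩ X₀`. -/
def canonicalAlgebra (S : TwoPrecontactSpace.{u}) : PrecontactAlgebra.{u} where
  carrier := rcPair S.X₀ S.dense
  C F G := ∃ x y : S.X₀, (x : S.X) ∈ (F : RC S.X) ∧ (y : S.X) ∈ (G : RC S.X) ∧ S.R x y
  isPrecontact :=
    { ne_bot := by
        rintro F G ⟨x, y, hx, hy, -⟩
        constructor
        · rintro rfl; exact hx
        · rintro rfl; exact hy
      sup_right := fun F G H => by
        have h : ∀ y : S.X, y ∈ ((G ⊔ H : rcPair S.X₀ S.dense) : RC S.X) ↔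
            y ∈ (G : RC S.X) ∨ y ∈ (H : RC S.X) := fun y => Iff.rfl
        simp only [h, or_and_right, and_or_left, exists_or]
      sup_left := fun F G H => by
        have h : ∀ y : S.X, y ∈ ((F ⊔ G : rcPair S.X₀ S.dense) : RC S.X) ↔
            y ∈ (F : RC S.X) ∨ y ∈ (G : RC S.X) := fun y => Iff.rfl
        simp only [h, or_and_right, exists_or] }

end TwoPrecontactSpace

/-! ### The canonical 2-precontact space of a precontact algebra -/

/-- The set `Clans(B, C)`. -/
structure Clan (B : PrecontactAlgebra.{u}) : Type u where
  carrier : Set B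
  isClan : IsClan B.C carrier

namespace Clan

variable {B : PrecontactAlgebra.{u}}

instance : SetLike (Clan B) B where
  coe := Clan.carrier
  coe_injective F G h := by cases F; cases G; congr

/-- `g_B(a)` is the set of all clans containing `a`. -/
def g (a : B) : Set (Clan B) := {Γ | a ∈ Γ}

/-- The topology having `{g_B(a) | a ∈ B}` as a closed base. -/
instance : TopologicalSpace (Clan B) :=
  TopologicalSpace.generateFrom {U | ∃ a : B, U = (g a)ᶜ}

variable (B) in
/-- `Ult(B)` as a subset of `Clans(B, C)`. -/
def ults : Set (Clan B) := {Γ | IsUlt (Γ : Set B)}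

variable (B) in
/-- `U R_B V` iff `U × V ⊆ C`. -/
def rel (U V : ults B) : Prop := ∀ a ∈ U.1, ∀ b ∈ V.1, B.C a b

theorem top_mem (Γ : Clan B) : (⊤ : B) ∈ Γ := by
  obtain ⟨a, ha⟩ := Γ.isClan.nonempty
  exact Γ.isClan.mem_of_le _ _ ha le_top

theorem sup_mem_iff (Γ : Clan B) (a b : B) : a ⊔ b ∈ Γ ↔ a ∈ Γ ∨ b ∈ Γ :=
  ⟨Γ.isClan.sup_mem a b, fun h => h.elim (fun h => Γ.isClan.mem_of_le _ _ h le_sup_left)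
    (fun h => Γ.isClan.mem_of_le _ _ h le_sup_right)⟩

theorem g_sup (a b : B) : g (a ⊔ b) = g a ∪ g b := by
  ext Γ; exact Γ.sup_mem_iff a b

theorem isClosedBase_g : IsClosedBase {F : Set (Clan B) | ∃ a : B, F = g a} := by
  have he : {U : Set (Clan B) | Uᶜ ∈ {F : Set (Clan B) | ∃ a : B, F = g a}} =
      {U | ∃ a : B, U = (g a)ᶜ} := by
    ext U
    exact exists_congr fun a => ⟨fun h => by rw [← h, compl_compl], fun h => by
      rw [h, compl_compl]⟩
  unfold IsClosedBase
  rw [he]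
  refine ⟨?_, ?_, rfl⟩
  · rintro _ ⟨a, rfl⟩ _ ⟨b, rfl⟩ x hx
    rw [← compl_union, ← g_sup] at *
    exact ⟨_, ⟨_, rfl⟩, hx, subset_rfl⟩
  · refine eq_univ_of_forall fun Γ => ?_
    exact ⟨(g ⊥)ᶜ, ⟨⊥, rfl⟩, Γ.isClan.bot_notMem⟩

theorem isOpen_compl_g (a : B) : IsOpen (g a)ᶜ :=
  TopologicalSpace.isOpen_generateFrom_of_mem ⟨a, rfl⟩

theorem isClosed_g (a : B) : IsClosed (g a) := ⟨isOpen_compl_g a⟩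

theorem exists_g_of_isOpen {U : Set (Clan B)} (hU : IsOpen U) {Γ : Clan B} (h : Γ ∈ U) :
    ∃ a : B, a ∉ Γ ∧ (g a)ᶜ ⊆ U := by
  obtain ⟨V, ⟨a, ha⟩, h1, h2⟩ := isClosedBase_g.exists_subset_of_mem_open h hU
  rw [compl_eq_comm] at ha
  subst ha
  exact ⟨a, h1, h2⟩

/-- An ultrafilter as a point of `Ult(B)`. -/
def ofUlt {U : Set B} (hU : IsUlt U) : ults B := ⟨⟨U, hU.isClan B.C⟩, hU⟩

theorem compl_mem_ult (U : ults B) (a : B) : aᶜ ∈ U.1 ↔ a ∉ U.1 :=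
  ⟨fun h h' => IsUlt.not_mem_and_compl U.2 a h' h,
    fun h => (IsUlt.mem_or_compl_mem U.2 a).resolve_left h⟩

/-- The Stone map. -/
def s (a : B) : Clopens (ults B) where
  carrier := Subtype.val ⁻¹' g a
  isClopen' := by
    refine ⟨(isClosed_g a).preimage continuous_subtype_val, ?_⟩
    have h : (Subtype.val ⁻¹' g a : Set (ults B)) = Subtype.val ⁻¹' (g aᶜ)ᶜ := by
      ext U
      change a ∈ U.1 ↔ aᶜ ∉ U.1
      rw [compl_mem_ult, not_not]
    rw [h]
    exact (isOpen_compl_g _).preimage continuous_subtype_val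

theorem mem_s {a : B} {U : ults B} : U ∈ s a ↔ a ∈ U.1 := Iff.rfl

theorem s_sup (a b : B) : s (a ⊔ b) = s a ⊔ s b := by
  ext U; exact U.1.sup_mem_iff a b

theorem s_mono {a b : B} (h : a ≤ b) : s a ≤ s b :=
  fun U hU => U.1.isClan.mem_of_le _ _ hU h

theorem clX_s (a : B) : clX (s a) = g a := by
  refine (closure_minimal ?_ (isClosed_g a)).antisymm fun Γ hΓ => ?_
  · rintro _ ⟨U, hU, rfl⟩; exact hU
  · refine mem_closure_iff.2 fun V hV hΓV => ?_
    obtain ⟨c, hc, hcV⟩ := exists_g_of_isOpen hV hΓV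
    have h1 : a ⊓ cᶜ ≠ ⊥ := fun h0 => hc (Γ.isClan.mem_of_le _ _ hΓ
      (by simpa using disjoint_iff.2 h0 |>.le_compl_right))
    obtain ⟨U, hU, hmem⟩ := exists_ult_of_ne_bot h1
    refine ⟨(ofUlt hU).1, hcV fun h => ?_, ofUlt hU, hU.mem_of_le _ _ hmem inf_le_left, rfl⟩
    exact hU.not_mem_and_compl c h (hU.mem_of_le _ _ hmem inf_le_right)

variable (B) in
theorem dense_ults : Dense (ults B) := by
  intro Γ
  have h : Γ ∈ clX (s (⊤ : B)) := by rw [clX_s]; exact Γ.top_mem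
  refine closure_mono ?_ h
  rintro _ ⟨U, -, rfl⟩; exact U.2

theorem exists_s_of_isOpen {V : Set (ults B)} (hV : IsOpen V) {U : ults B} (h : U ∈ V) :
    ∃ a : B, U ∈ s a ∧ (s a : Set (ults B)) ⊆ V := by
  obtain ⟨W, hW, rfl⟩ := isOpen_induced_iff.1 hV
  obtain ⟨c, hc, hcW⟩ := exists_g_of_isOpen hW h
  refine ⟨cᶜ, (compl_mem_ult U c).2 hc, fun T hT => hcW ?_⟩
  exact (compl_mem_ult T c).1 hT

variable (B) in
theorem compactSpace_ults : CompactSpace (ults B) := by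
  refine ⟨isCompact_iff_ultrafilter_le_nhds.2 fun 𝓕 _ => ?_⟩
  have hu : IsUlt {a : B | (s a : Set (ults B)) ∈ 𝓕} := by
    refine ⟨?_, ?_, ?_, ?_, ?_⟩
    · exact Filter.mem_of_superset Filter.univ_mem fun U _ => U.1.top_mem
    · intro h
      obtain ⟨U, hU⟩ := 𝓕.nonempty_of_mem h
      exact U.1.isClan.bot_notMem hU
    · exact fun a b ha hab => Filter.mem_of_superset ha (s_mono hab)
    · exact fun a b ha hb => Filter.mem_of_superset (Filter.inter_mem ha hb)
        fun U hU => IsUlt.inf_mem U.2 _ _ hU.1 hU.2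
    · intro a
      have h := 𝓕.mem_or_compl_mem (s a : Set (ults B))
      refine h.imp id fun h => Filter.mem_of_superset h fun U hU => (compl_mem_ult U a).2 hU
  refine ⟨ofUlt hu, mem_univ _, fun V hV => ?_⟩
  obtain ⟨W, hWV, hW, hmem⟩ := mem_nhds_iff.1 hV
  obtain ⟨a, ha, haW⟩ := exists_s_of_isOpen hW hmem
  exact Filter.mem_of_superset (show (s a : Set (ults B)) ∈ 𝓕 from ha) (haW.trans hWV)

theorem exists_eq_s (F : Clopens (ults B)) : ∃ a : B, F = s a := by
  have := compactSpace_ults B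
  let ι := {a : B // s a ≤ F}
  have : Nonempty ι := ⟨⟨⊥, fun U hU => (U.1.isClan.bot_notMem hU).elim⟩⟩
  obtain ⟨⟨a, ha⟩, h⟩ := F.isClosed.isCompact.elim_directed_cover
    (fun i : ι => (s i.1 : Set (ults B))) (fun i => (s i.1).isOpen)
    (fun U hU => by
      obtain ⟨a, ha, haF⟩ := exists_s_of_isOpen F.isOpen hU
      exact mem_iUnion.2 ⟨⟨a, haF⟩, ha⟩)
    (fun i j => ⟨⟨i.1 ⊔ j.1, by rw [s_sup]; exact sup_le i.2 j.2⟩,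
      s_mono le_sup_left, s_mono le_sup_right⟩)
  exact ⟨a, le_antisymm h ha⟩

theorem clopenRel_s (a b : B) : clopenRel (rel B) (s a) (s b) ↔ B.C a b := by
  constructor
  · rintro ⟨U, hU, V, hV, h⟩
    exact h a hU b hV
  · intro h
    obtain ⟨U, V, hU, hV, ha, hb, h⟩ := B.isPrecontact.exists_ult_pair h
    exact ⟨ofUlt hU, ha, ofUlt hV, hb, h⟩

theorem s_inf_ne_bot (a b : B) : s a ⊓ s b ≠ ⊥ ↔ a ⊓ b ≠ ⊥ := by
  constructor
  · rintro h h0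
    refine h (le_bot_iff.1 fun U hU => ?_)
    have h1 := IsUlt.inf_mem U.2 _ _ hU.1 hU.2
    rw [h0] at h1
    exact U.1.isClan.bot_notMem h1
  · intro h h0
    obtain ⟨U, hU, hab⟩ := exists_ult_of_ne_bot h
    have h1 : ofUlt hU ∈ s a ⊓ s b :=
      ⟨hU.mem_of_le _ _ hab inf_le_left, hU.mem_of_le _ _ hab inf_le_right⟩
    rw [h0] at h1
    exact h1

theorem sharpRel_s (a b : B) : sharpRel (clopenRel (rel B)) (s a) (s b) ↔ sharpRel B.C a b := by
  unfold sharpRel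
  rw [clopenRel_s, clopenRel_s, s_inf_ne_bot]

variable (B) in
theorem isStoneAdjacency : IsStoneAdjacency (rel B) where
  compact := compactSpace_ults B
  t2 := by
    refine ⟨fun U V hUV => ?_⟩
    obtain ⟨a, ha, ha'⟩ : ∃ a : B, a ∈ U.1 ∧ a ∉ V.1 := by
      by_contra! h
      refine hUV (Subtype.ext (SetLike.ext fun a => ⟨h a, fun ha => ?_⟩))
      by_contra hn
      exact (compl_mem_ult V a).1 (h _ ((compl_mem_ult U a).2 hn)) ha
    refine ⟨s a, (s a : Set (ults B))ᶜ, (s a).isOpen, (s a).isClosed.isOpen_compl, ha, ha',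
      disjoint_compl_right⟩
  zeroDim := by
    refine isTopologicalBasis_of_isOpen_of_nhds (fun V hV => hV.isOpen) fun U V hU hV => ?_
    obtain ⟨a, ha, haV⟩ := exists_s_of_isOpen hV hU
    exact ⟨s a, (s a).isClopen, ha, haV⟩
  isClosed_rel := by
    refine ⟨isOpen_iff_forall_mem_open.2 ?_⟩
    rintro ⟨U, V⟩ h
    simp only [mem_compl_iff, mem_ofPred_eq, rel, not_forall] at h
    obtain ⟨a, ha, b, hb, hab⟩ := h
    refine ⟨(s a : Set (ults B)) ×ˢ (s b : Set (ults B)), ?_,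
      (s a).isOpen.prod (s b).isOpen, ⟨ha, hb⟩⟩
    rintro ⟨U', V'⟩ ⟨h1, h2⟩ h3
    exact hab (h3 a h1 b h2)

end Clan

/-- The canonical 2-precontact space `(Clans(B, C), Ult(B), R_B)` of `(B, C)`. -/
def PrecontactAlgebra.canonicalSpace (B : PrecontactAlgebra.{u}) : TwoPrecontactSpace.{u} where
  X := Clan B
  X₀ := Clan.ults B
  R := Clan.rel B
  dense := Clan.dense_ults B
  t0 := by
    refine ⟨fun Γ Δ h => SetLike.ext fun a => ?_⟩
    exact not_iff_not.1 (h.mem_open_iff (Clan.isOpen_compl_g a))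
  stone := Clan.isStoneAdjacency B
  closedBase := by
    have h : rcPairSet (Clan.ults B) = {F | ∃ a : B, F = Clan.g a} := by
      ext F
      constructor
      · rintro ⟨A, rfl⟩
        obtain ⟨a, rfl⟩ := Clan.exists_eq_s A
        exact ⟨a, Clan.clX_s a⟩
      · rintro ⟨a, rfl⟩
        exact ⟨Clan.s a, (Clan.clX_s a).symm⟩
    rw [h]
    exact Clan.isClosedBase_g
  sharp_of_inter F G h := by
    obtain ⟨a, rfl⟩ := Clan.exists_eq_s F
    obtain ⟨b, rfl⟩ := Clan.exists_eq_s G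
    rw [Clan.clX_s, Clan.clX_s] at h
    obtain ⟨Γ, ha, hb⟩ := h
    exact (Clan.sharpRel_s a b).2 (Γ.isClan.sharp a b ha hb)
  exists_point Γ hΓ := by
    refine ⟨⟨{a | Clan.s a ∈ Γ}, ?_⟩, ?_⟩
    · refine ⟨?_, ?_, ?_, ?_, ?_⟩
      · obtain ⟨F, hF⟩ := hΓ.nonempty
        obtain ⟨a, rfl⟩ := Clan.exists_eq_s F
        exact ⟨a, hF⟩
      · intro h
        have h0 : Clan.s (⊥ : B) = ⊥ :=
          le_bot_iff.1 fun U hU => (U.1.isClan.bot_notMem hU).elim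
        exact hΓ.bot_notMem (h0 ▸ h)
      · exact fun a b ha hab => hΓ.mem_of_le _ _ ha (Clan.s_mono hab)
      · intro a b hab
        refine hΓ.sup_mem _ _ ?_
        rw [← Clan.s_sup]; exact hab
      · exact fun a b ha hb => (Clan.sharpRel_s a b).1 (hΓ.sharp _ _ ha hb)
    · ext F
      obtain ⟨a, rfl⟩ := Clan.exists_eq_s F
      rw [mem_ofPred_eq, Clan.clX_s]
      rfl

end Precontact

open Precontact

/-! The argument is Stone duality for `B`, with the clans filling in the extra points of `X`.

The Stone map `a ↦ s a` is an isomorphism of `B` onto the clopen subsets of `X₀ = Ult(B)`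
(`Clan.stoneIso`), and for every 2-precontact space `A ↦ cl_X A` is an isomorphism of `CO(X₀)` onto
`RC(X, X₀)` (`clopensIso`), because `cl_X A` meets `X₀` in `A`. Their composite is `g_B`. The
relations correspond since `a C b` holds iff some ultrafilters `U ∋ a`, `V ∋ b` satisfy
`U × V ⊆ C`; for a pair obtained in this way from `C^#`, the union `U ∪ V` is a clan, so `a C^# b`
holds iff `g a` and `g b` meet
(`Clan.g_inter_nonempty_iff`). The axioms are then read off `R`. In the case of (Ctr), if no `b`
interpolates `a ≪ c`, then the filter of all `b` with `a ≪ b` lies in the grill of all `b` with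
`b C cᶜ`, so an ultrafilter between the two links some ultrafilter around `a` to one around `cᶜ`.
A clopen subset of `X` has the form `g a`, whence the statement on connectedness, and the join of
`{a | g a ⊆ F}` represents a regular closed `F`, whence the one on completeness.

The correspondence of isomorphism classes rests on a single reconstruction principle
(`TwoPrecontactSpace.nonempty_iso_canonicalSpace`): if an isomorphism `ψ` of a precontact algebra `A`
onto `(CO(X₀), C_R)` is given, then `x ↦ {a | x ∈ cl_X (ψ a)}` is an isomorphism of `(X, X₀, R)`
onto the canonical space of `A`. It is injective by the `T₀` axiom, onto by the axiom on clans, and a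
homeomorphism as the closed bases match; ultrafilters come from points of `X₀` by compactness, and
`R` is recovered from `C_R` because it is closed. With `A` the algebra of `S` this gives
`X(B(S)) ≅ S`; with `S` the space of an algebra isomorphic to `A`, it gives the invariance of
`X(·)`. -/

namespace Precontact

/-! ### Clopen subsets of the dense part -/

section Pairs

variable {X : Type u} [TopologicalSpace X] {X₀ : Set X}

theorem coe_mem_clX {A : Clopens X₀} {x : X₀} : (x : X) ∈ clX A ↔ x ∈ A := by
  have h : x ∈ closure (A : Set X₀) ↔ (x : X) ∈ clX A := closure_subtype
  rw [← h, A.isClosed.closure_eq]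
  rfl

theorem clX_subset_clX {A A' : Clopens X₀} : clX A ⊆ clX A' ↔ A ≤ A' :=
  ⟨fun h _ hx => coe_mem_clX.1 (h (coe_mem_clX.2 hx)), fun h => closure_mono (image_mono h)⟩

/-- The isomorphism `A ↦ cl_X A` of `CO(X₀)` onto `RC(X, X₀)`. -/
noncomputable def clopensIso (hd : Dense X₀) : Clopens X₀ ≃o rcPair X₀ hd :=
  RelIso.ofSurjective
    (OrderEmbedding.ofMapLEIff (fun A => ⟨⟨clX A, clX_regular hd A⟩, A, rfl⟩)
      fun _ _ => clX_subset_clX)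
    (by
      rintro ⟨F, A, hA⟩
      exact ⟨A, Subtype.ext (SetLike.coe_injective hA.symm)⟩)

theorem coe_clopensIso (hd : Dense X₀) (A : Clopens X₀) :
    ((clopensIso hd A : RC X) : Set X) = clX A := rfl

/-- A clopen subset of `X` is the closure of its trace on the dense subspace. -/
theorem exists_eq_clX_of_isClopen (hd : Dense X₀) {U : Set X} (hU : IsClopen U) :
    ∃ A : Clopens X₀, U = clX A := by
  refine ⟨⟨Subtype.val ⁻¹' U, hU.preimage continuous_subtype_val⟩, ?_⟩
  have h : clX (X₀ := X₀) ⟨Subtype.val ⁻¹' U, hU.preimage continuous_subtype_val⟩ =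
      closure (U ∩ X₀) := by
    change closure (Subtype.val '' (Subtype.val ⁻¹' U)) = _
    rw [Subtype.image_preimage_coe, inter_comm]
  rw [h]
  exact (hd.open_subset_closure_inter hU.isOpen).antisymm
    (closure_minimal inter_subset_left hU.isClosed)

end Pairs

theorem TwoPrecontactSpace.canonicalAlgebra_C_clopensIso (S : TwoPrecontactSpace.{u})
    (F G : Clopens S.X₀) :
    S.canonicalAlgebra.C (clopensIso S.dense F) (clopensIso S.dense G) ↔ clopenRel S.R F G := by
  constructor
  · rintro ⟨x, y, hx, hy, h⟩
    exact ⟨x, coe_mem_clX.1 hx, y, coe_mem_clX.1 hy, h⟩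
  · rintro ⟨x, hx, y, hy, h⟩
    exact ⟨x, y, coe_mem_clX.2 hx, coe_mem_clX.2 hy, h⟩

theorem TwoPrecontactSpace.canonicalAlgebra_C_iff (S : TwoPrecontactSpace.{u})
    (F G : rcPair S.X₀ S.dense) :
    S.canonicalAlgebra.C F G ↔
      clopenRel S.R ((clopensIso S.dense).symm F) ((clopensIso S.dense).symm G) := by
  rw [← S.canonicalAlgebra_C_clopensIso, OrderIso.apply_symm_apply, OrderIso.apply_symm_apply]

theorem TwoPrecontactSpace.contactAlgebra_isContact (S : TwoPrecontactSpace.{u}) :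
    S.contactAlgebra.IsContact := by
  refine ⟨fun (F : rcPair S.X₀ S.dense) hF => ?_, fun (F G : rcPair S.X₀ S.dense) h => ?_⟩
  · change (((F : RC S.X) : Set S.X) ∩ ((F : RC S.X) : Set S.X)).Nonempty
    rw [inter_self, nonempty_iff_ne_empty]
    intro h
    exact hF (Subtype.ext (SetLike.coe_injective h))
  · change (((G : RC S.X) : Set S.X) ∩ ((F : RC S.X) : Set S.X)).Nonempty
    rw [inter_comm]
    exact h

/-! ### Ultrafilters and the precontact relation -/

section Ultrafilters

variable {B : Type u} [BooleanAlgebra B] {C : B → B → Prop}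

theorem IsPrecontact.flip (h : IsPrecontact C) : IsPrecontact (fun a b => C b a) where
  ne_bot a b hab := (h.ne_bot b a hab).symm
  sup_right a b c := h.sup_left b c a
  sup_left a b c := h.sup_right c a b

theorem IsPrecontact.exists_ult_left (h : IsPrecontact C) {V : Set B} (hV : IsUlt V) {a : B}
    (ha : ∀ y ∈ V, C a y) : ∃ U : Set B, IsUlt U ∧ a ∈ U ∧ ∀ x ∈ U, ∀ y ∈ V, C x y := by
  refine exists_ult (G := {x : B | ∀ y ∈ V, C x y})
    (fun h0 => (h.ne_bot _ _ (h0 ⊤ hV.top_mem)).1 rfl)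
    (fun x y hx hxy z hz => h.mono hxy le_rfl (hx z hz)) (fun x y hxy => ?_) ha
  by_contra! hn
  simp only [mem_ofPred_eq, not_forall] at hn
  obtain ⟨⟨p, hp, hp'⟩, q, hq, hq'⟩ := hn
  rcases (h.sup_left _ _ _).1 (hxy _ (hV.inf_mem _ _ hp hq)) with h1 | h1
  · exact hp' (h.mono le_rfl inf_le_left h1)
  · exact hq' (h.mono le_rfl inf_le_right h1)

/-- If `a ≪ c` has no interpolant, some ultrafilter `V` contains the filter `{b | a ≪ b}` and
lies in the grill `{b | b C c*}`; the first property says that `a C y` for all `y ∈ V`. -/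
theorem IsPrecontact.exists_ult_of_no_interpolant (h : IsPrecontact C) {a c : B}
    (hn : ∀ b, NonTang C a b → ¬ NonTang C b c) :
    ∃ V : Set B, IsUlt V ∧ (∀ y ∈ V, C a y) ∧ ∀ y ∈ V, C y cᶜ := by
  obtain ⟨V, hV, -, hVG⟩ := exists_ult (G := {b : B | ∀ f, NonTang C a f → C (b ⊓ f) cᶜ})
    (a := ⊤)
    (fun h0 => by
      have h1 := h0 ⊤ fun h2 => (h.ne_bot _ _ h2).2 compl_top
      rw [bot_inf_eq] at h1
      exact (h.ne_bot _ _ h1).1 rfl)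
    (fun x y hx hxy f hf => h.mono (inf_le_inf_right f hxy) le_rfl (hx f hf))
    (fun x y hxy => by
      by_contra! hcon
      simp only [mem_ofPred_eq, not_forall] at hcon
      obtain ⟨⟨p, hp, hp'⟩, q, hq, hq'⟩ := hcon
      have hpq : NonTang C a (p ⊓ q) := by
        intro h1
        rw [compl_inf, h.sup_right] at h1
        exact h1.elim hp hq
      have h1 := hxy _ hpq
      rw [inf_sup_right, h.sup_left] at h1
      rcases h1 with h1 | h1
      · exact hp' (h.mono (inf_le_inf_left x inf_le_left) le_rfl h1)
      · exact hq' (h.mono (inf_le_inf_left y inf_le_right) le_rfl h1))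
    (fun f hf => by
      rw [top_inf_eq]
      exact not_not.1 (hn f hf))
  refine ⟨V, hV, fun y hy => ?_, fun y hy => ?_⟩
  · by_contra hay
    have h1 := hVG hy yᶜ (by rwa [NonTang, compl_compl])
    rw [inf_compl_eq_bot] at h1
    exact (h.ne_bot _ _ h1).1 rfl
  · have h1 := hVG hy ⊤ fun h2 => (h.ne_bot _ _ h2).2 compl_top
    rwa [inf_top_eq] at h1

theorem sharpRel_symm {a b : B} (h : sharpRel C a b) : sharpRel C b a := by
  rcases h with h | h | h
  · exact Or.inr (Or.inl h)
  · exact Or.inl h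
  · exact Or.inr (Or.inr (by rwa [inf_comm]))

theorem IsClan.union {U V : Set B} (hU : IsClan C U) (hV : IsClan C V)
    (hUV : ∀ x ∈ U, ∀ y ∈ V, sharpRel C x y) : IsClan C (U ∪ V) where
  nonempty := hU.nonempty.mono subset_union_left
  bot_notMem := fun h => h.elim hU.bot_notMem hV.bot_notMem
  mem_of_le a b h hab := h.imp (fun h => hU.mem_of_le a b h hab) fun h => hV.mem_of_le a b h hab
  sup_mem a b h := by
    rcases h with h | h
    · exact (hU.sup_mem a b h).imp Or.inl Or.inl
    · exact (hV.sup_mem a b h).imp Or.inr Or.inr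
  sharp a b ha hb := by
    rcases ha with ha | ha <;> rcases hb with hb | hb
    · exact hU.sharp a b ha hb
    · exact hUV a ha b hb
    · exact sharpRel_symm (hUV b hb a ha)
    · exact hV.sharp a b ha hb

theorem IsUlt.eq_of_subset {U V : Set B} (hU : IsUlt U) (hV : IsUlt V) (h : U ⊆ V) : U = V :=
  h.antisymm fun a ha =>
    (hU.mem_or_compl_mem a).resolve_right fun h' => hV.not_mem_and_compl a ha (h h')

end Ultrafilters

/-! ### The canonical space of a precontact algebra -/

namespace Clan

variable {B : PrecontactAlgebra.{u}}

theorem s_le_s {a b : B} : s a ≤ s b ↔ a ≤ b := by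
  refine ⟨fun h => ?_, s_mono⟩
  by_contra hn
  obtain ⟨U, hU, hab⟩ := exists_ult_of_ne_bot fun h0 : a ⊓ bᶜ = ⊥ =>
    hn (by simpa using (disjoint_iff.2 h0).le_compl_right)
  exact hU.not_mem_and_compl b (h (show ofUlt hU ∈ s a from hU.mem_of_le _ _ hab inf_le_left))
    (hU.mem_of_le _ _ hab inf_le_right)

theorem g_subset_g {a b : B} : g a ⊆ g b ↔ a ≤ b := by
  rw [← clX_s, ← clX_s, clX_subset_clX, s_le_s]

theorem g_bot : g (⊥ : B) = ∅ := eq_empty_of_forall_notMem fun Γ => Γ.isClan.bot_notMem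

theorem g_top : g (⊤ : B) = univ := eq_univ_of_forall fun Γ => Γ.top_mem

theorem closure_compl_g (a : B) : closure (g a)ᶜ = g aᶜ := by
  refine (closure_minimal (fun Γ hΓ => ?_) (isClosed_g _)).antisymm ?_
  · have h : a ⊔ aᶜ ∈ Γ := by rw [sup_compl_eq_top]; exact Γ.top_mem
    exact ((Γ.sup_mem_iff _ _).1 h).resolve_left hΓ
  · rw [← clX_s]
    refine closure_mono ?_
    rintro _ ⟨U, hU, rfl⟩
    exact (compl_mem_ult U a).1 hU

variable (B) in
/-- The Stone isomorphism of `B` onto the clopen subsets of its space of ultrafilters. -/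
noncomputable def stoneIso : B ≃o Clopens (ults B) :=
  RelIso.ofSurjective (OrderEmbedding.ofMapLEIff s fun _ _ => s_le_s)
    fun F => (exists_eq_s F).imp fun _ h => h.symm

theorem exists_eq_g_of_isClopen {F : Set (Clan B)} (hF : IsClopen F) : ∃ a : B, F = g a := by
  obtain ⟨A, rfl⟩ := exists_eq_clX_of_isClopen (dense_ults B) hF
  obtain ⟨a, rfl⟩ := exists_eq_s A
  exact ⟨a, clX_s a⟩

theorem g_inter_nonempty_iff {a b : B} : (g a ∩ g b).Nonempty ↔ sharpRel B.C a b := by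
  constructor
  · rintro ⟨Γ, ha, hb⟩
    exact Γ.isClan.sharp a b ha hb
  · intro h
    obtain ⟨U, V, hU, hV, ha, hb, hUV⟩ := B.isPrecontact.sharpRel.exists_ult_pair h
    exact ⟨⟨U ∪ V, (hU.isClan B.C).union (hV.isClan B.C) hUV⟩, Or.inl ha, Or.inr hb⟩

end Clan

namespace PrecontactAlgebra

variable (B : PrecontactAlgebra.{u})

/-- The map `g_B` as an isomorphism of Boolean algebras onto `RC(X, X₀)`. -/
noncomputable def gIso : B ≃o rcPair (Clan.ults B) (Clan.dense_ults B) :=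
  (Clan.stoneIso B).trans (clopensIso (Clan.dense_ults B))

theorem coe_gIso (a : B) : ((B.gIso a : RC (Clan B)) : Set (Clan B)) = Clan.g a :=
  Clan.clX_s a

/-- The map `g_B` as an isomorphism of precontact algebras. -/
noncomputable def isoCanonicalAlgebra : Iso B B.canonicalSpace.canonicalAlgebra where
  toOrderIso := B.gIso
  map_rel a b := (Clan.clopenRel_s a b).symm.trans
    (B.canonicalSpace.canonicalAlgebra_C_clopensIso (Clan.s a) (Clan.s b)).symm

/-- The map `g_B` as an isomorphism of contact algebras from `(B, C^#)`. -/
noncomputable def isoContactAlgebra : Iso B.sharp B.canonicalSpace.contactAlgebra where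
  toOrderIso := B.gIso
  map_rel := fun (a b : B) => by
    change sharpRel B.C a b ↔ (((B.gIso a : RC (Clan B)) : Set (Clan B)) ∩
      ((B.gIso b : RC (Clan B)) : Set (Clan B))).Nonempty
    rw [coe_gIso, coe_gIso, Clan.g_inter_nonempty_iff]

theorem sharp_isContact : B.sharp.IsContact := by
  refine ⟨fun (a : B) ha => Or.inr (Or.inr ?_), fun a b h => sharpRel_symm h⟩
  rwa [inf_idem]

theorem rcPairSet_ults : rcPairSet (Clan.ults B) = {F | ∃ a : B, F = Clan.g a} := by
  ext F
  constructor
  · rintro ⟨A, rfl⟩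
    obtain ⟨a, rfl⟩ := Clan.exists_eq_s A
    exact ⟨a, Clan.clX_s a⟩
  · rintro ⟨a, rfl⟩
    exact ⟨Clan.s a, (Clan.clX_s a).symm⟩

theorem closure_interior_g (a : B) : closure (interior (Clan.g a)) = Clan.g a := by
  rw [← Clan.clX_s]
  exact clX_regular (Clan.dense_ults B) _

/-- If all regular closed sets are of the form `g a`, the join of `S` is the element
representing the closure of the union of the interiors of the sets `g a`, `a ∈ S`. -/
theorem exists_isLUB_of_regularClosed
    (h : ∀ F : Set (Clan B), closure (interior F) = F → ∃ a : B, F = Clan.g a) (S : Set B) :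
    ∃ b : B, IsLUB S b := by
  obtain ⟨b, hb⟩ := h (closure (⋃ a ∈ S, interior (Clan.g a)))
    (RC.closure_interior_of_isOpen (isOpen_biUnion fun _ _ => isOpen_interior))
  refine ⟨b, fun a ha => ?_, fun c hc => ?_⟩
  · rw [← Clan.g_subset_g, ← hb, ← B.closure_interior_g a]
    exact closure_mono (subset_biUnion_of_mem (u := fun a => interior (Clan.g a)) ha)
  · rw [← Clan.g_subset_g, ← hb]
    exact closure_minimal
      (iUnion₂_subset fun a ha => interior_subset.trans (Clan.g_subset_g.2 (hc ha)))
      (Clan.isClosed_g c)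

/-- A regular closed set `F` is represented by the join of all `a` with `g a ⊆ F`. -/
theorem eq_g_of_isLUB {F : Set (Clan B)} (hF : closure (interior F) = F) {b : B}
    (hb : IsLUB {a : B | Clan.g a ⊆ F} b) : F = Clan.g b := by
  have hcl : IsClosed F := hF ▸ isClosed_closure
  apply Subset.antisymm
  · rw [← hF]
    refine closure_minimal (fun Γ hΓ => ?_) (Clan.isClosed_g b)
    obtain ⟨c, hc, hcF⟩ := Clan.exists_g_of_isOpen isOpen_interior hΓ
    have hcb : cᶜ ≤ b := hb.1 <| by
      change Clan.g cᶜ ⊆ F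
      rw [← Clan.closure_compl_g]
      exact closure_minimal (hcF.trans interior_subset) hcl
    have h1 : Γ ∈ Clan.g cᶜ := by
      rw [← Clan.closure_compl_g]
      exact subset_closure hc
    exact Clan.g_subset_g.2 hcb h1
  · intro Γ hΓ
    by_contra hn
    -- `g b` is regular, so its interior meets the open set `Fᶜ` in some nonempty `(g c)ᶜ`;
    -- then `c` is an upper bound, and `cᶜ ≤ b ≤ c` forces `c = ⊤`.
    rw [← B.closure_interior_g b] at hΓ
    obtain ⟨Δ, hΔF, hΔ⟩ := mem_closure_iff.1 hΓ _ hcl.isOpen_compl hn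
    obtain ⟨c, hc, hcF⟩ :=
      Clan.exists_g_of_isOpen (hcl.isOpen_compl.inter isOpen_interior) ⟨hΔF, hΔ⟩
    have hcb : cᶜ ≤ b := by
      rw [← Clan.g_subset_g, ← Clan.closure_compl_g]
      exact closure_minimal (hcF.trans (inter_subset_right.trans interior_subset))
        (Clan.isClosed_g b)
    have hbc : b ≤ c := hb.2 fun a ha => by
      rw [← Clan.g_subset_g]
      intro Θ hΘ
      by_contra hΘc
      exact (hcF hΘc).1 (ha hΘ)
    have htop : c = ⊤ := by
      rw [← top_le_iff, ← compl_sup_eq_top (x := c)]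
      exact sup_le (hcb.trans hbc) le_rfl
    exact hc (htop ▸ Δ.top_mem)

theorem regularClosed_eq_rcPairSet_iff :
    {F : Set B.canonicalSpace.X | closure (interior F) = F} = rcPairSet B.canonicalSpace.X₀ ↔
      B.IsComplete := by
  change {F : Set (Clan B) | closure (interior F) = F} = rcPairSet (Clan.ults B) ↔ _
  rw [rcPairSet_ults]
  constructor
  · exact fun h => B.exists_isLUB_of_regularClosed fun F hF => h.subset hF
  · intro h
    ext F
    constructor
    · intro hF
      obtain ⟨b, hb⟩ := h {a : B | Clan.g a ⊆ F}
      exact ⟨b, B.eq_g_of_isLUB hF hb⟩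
    · rintro ⟨a, rfl⟩
      exact B.closure_interior_g a

theorem axRef_iff : AxRef B.C ↔ B.canonicalSpace.IsReflexive := by
  constructor
  · intro h U a ha b hb
    have h1 : a ⊓ b ≠ ⊥ := fun h0 => U.1.isClan.bot_notMem (h0 ▸ IsUlt.inf_mem U.2 a b ha hb)
    exact B.isPrecontact.mono inf_le_left inf_le_right (h _ h1)
  · intro h a ha
    obtain ⟨U, hU, haU⟩ := exists_ult_of_ne_bot ha
    exact h (Clan.ofUlt hU) a haU a haU

theorem axSym_iff : AxSym B.C ↔ B.canonicalSpace.IsSymmetric := by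
  constructor
  · exact fun h U V hUV a ha b hb => h b a (hUV b hb a ha)
  · intro h a b hab
    obtain ⟨U, V, hU, hV, ha, hb, hUV⟩ := B.isPrecontact.exists_ult_pair hab
    exact h (Clan.ofUlt hU) (Clan.ofUlt hV) hUV b hb a ha

theorem axTr_iff : AxTr B.C ↔ B.canonicalSpace.IsTransitive := by
  constructor
  · intro h U V W hUV hVW a ha c hc
    by_contra hac
    obtain ⟨b, hab, hbc⟩ := h a cᶜ (by rwa [NonTang, compl_compl])
    rw [NonTang, compl_compl] at hbc
    rcases IsUlt.mem_or_compl_mem V.2 b with hb | hb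
    · exact hbc (hVW b hb c hc)
    · exact hab (hUV a ha _ hb)
  · intro h a c hac
    by_contra! hn
    obtain ⟨V, hV, haV, hVc⟩ := B.isPrecontact.exists_ult_of_no_interpolant hn
    obtain ⟨U, hU, ha, hUV⟩ := B.isPrecontact.exists_ult_left hV haV
    obtain ⟨W, hW, hc, hVW⟩ := B.isPrecontact.flip.exists_ult_left hV hVc
    exact hac (h (Clan.ofUlt hU) (Clan.ofUlt hV) (Clan.ofUlt hW) hUV
      (fun y hy z hz => hVW z hz y hy) a ha _ hc)

theorem isConnected_iff : B.IsConnected ↔ B.canonicalSpace.IsConnected := by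
  change AxCon B.C ↔ PreconnectedSpace (Clan B)
  rw [preconnectedSpace_iff_clopen]
  constructor
  · intro h F hF
    obtain ⟨a, rfl⟩ := Clan.exists_eq_g_of_isClopen hF
    by_contra! hn
    have hdis : ¬ (Clan.g a ∩ Clan.g aᶜ).Nonempty := by
      rw [← Clan.closure_compl_g, hF.compl.isClosed.closure_eq, inter_compl_self]
      exact not_nonempty_empty
    rw [Clan.g_inter_nonempty_iff] at hdis
    refine hdis ((h a ?_ ?_).imp_right Or.inl)
    · rintro rfl
      exact hn.1.ne_empty Clan.g_bot
    · rintro rfl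
      exact hn.2 Clan.g_top
  · intro h a h0 h1
    by_contra hn
    have hdis : ¬ (Clan.g a ∩ Clan.g aᶜ).Nonempty := by
      rw [Clan.g_inter_nonempty_iff]
      rintro (h2 | h2 | h2)
      · exact hn (Or.inl h2)
      · exact hn (Or.inr h2)
      · exact h2 inf_compl_eq_bot
    have hcompl : (Clan.g a)ᶜ = Clan.g aᶜ := by
      refine (Clan.closure_compl_g a ▸ subset_closure).antisymm fun Γ hΓ hΓ' => hdis ⟨Γ, hΓ', hΓ⟩
    have hclopen : IsClopen (Clan.g a) :=
      ⟨Clan.isClosed_g a, isClosed_compl_iff.1 (hcompl ▸ Clan.isClosed_g aᶜ)⟩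
    rcases h _ hclopen with h2 | h2
    · exact h0 (le_bot_iff.1 (Clan.g_subset_g.1 (h2.trans Clan.g_bot.symm).subset))
    · exact h1 (top_le_iff.1 (Clan.g_subset_g.1 (h2.trans Clan.g_top.symm).symm.subset))

theorem nontrivial_iff : Nontrivial B ↔ B.canonicalSpace.X₀.Nonempty := by
  constructor
  · intro h
    obtain ⟨U, hU, -⟩ := exists_ult_of_ne_bot (top_ne_bot (α := B))
    exact ⟨(Clan.ofUlt hU).1, hU⟩
  · rintro ⟨Γ, hΓ⟩
    exact ⟨⊤, ⊥, fun h => hΓ.bot_notMem (h ▸ hΓ.top_mem)⟩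

end PrecontactAlgebra

/-! ### Reconstruction of a 2-precontact space -/

namespace TwoPrecontactSpace

theorem sharpRel_iff (S : TwoPrecontactSpace.{u}) {A : PrecontactAlgebra.{u}}
    (ψ : A ≃o Clopens S.X₀) (hψ : ∀ a b : A, A.C a b ↔ clopenRel S.R (ψ a) (ψ b)) (a b : A) :
    sharpRel A.C a b ↔ sharpRel (clopenRel S.R) (ψ a) (ψ b) := by
  unfold sharpRel
  rw [hψ, hψ, ← map_inf, Ne, Ne, map_eq_bot_iff]

/-- The clan of all elements whose region contains a given point, where an algebra `A` is
identified with `(CO(X₀), C_R)` by means of `ψ`. -/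
def toClan (S : TwoPrecontactSpace.{u}) {A : PrecontactAlgebra.{u}} (ψ : A ≃o Clopens S.X₀)
    (hψ : ∀ a b : A, A.C a b ↔ clopenRel S.R (ψ a) (ψ b)) (x : S.X) : Clan A where
  carrier := {a | x ∈ clX (ψ a)}
  isClan :=
    { nonempty := ⟨⊤, by
        have h : clX (⊤ : Clopens S.X₀) = univ := by
          simpa [clX] using S.dense.closure_eq
        rw [mem_ofPred_eq, map_top, h]
        trivial⟩
      bot_notMem := by
        rw [mem_ofPred_eq, map_bot]
        simp [clX]
      mem_of_le := fun a b ha hab => clX_subset_clX.2 (ψ.monotone hab) ha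
      sup_mem := fun a b hab => by
        rw [mem_ofPred_eq, map_sup, clX_sup] at hab
        exact hab
      sharp := fun a b ha hb =>
        (S.sharpRel_iff ψ hψ a b).2 (S.sharp_of_inter _ _ ⟨x, ha, hb⟩) }

section Reconstruction

variable {S : TwoPrecontactSpace.{u}} {A : PrecontactAlgebra.{u}} {ψ : A ≃o Clopens S.X₀}
  {hψ : ∀ a b : A, A.C a b ↔ clopenRel S.R (ψ a) (ψ b)}

theorem isInducing_toClan : Topology.IsInducing (S.toClan ψ hψ) := by
  refine ⟨?_⟩
  change _ = TopologicalSpace.induced _ (TopologicalSpace.generateFrom _)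
  rw [S.closedBase.eq_generateFrom, induced_generateFrom_eq]
  congr 1
  ext U
  constructor
  · rintro ⟨F, hF⟩
    refine ⟨(Clan.g (ψ.symm F))ᶜ, ⟨_, rfl⟩, ?_⟩
    rw [← compl_compl U, hF]
    ext x
    change x ∉ clX (ψ (ψ.symm F)) ↔ x ∉ clX F
    rw [OrderIso.apply_symm_apply]
  · rintro ⟨_, ⟨a, rfl⟩, rfl⟩
    exact ⟨ψ a, compl_compl _⟩

theorem bijective_toClan : Function.Bijective (S.toClan ψ hψ) := by
  have := S.t0
  refine ⟨isInducing_toClan.injective, fun Γ => ?_⟩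
  obtain ⟨x, hx⟩ := S.exists_point {F | ψ.symm F ∈ Γ}
    { nonempty := ⟨ψ ⊤, by
        rw [mem_ofPred_eq, OrderIso.symm_apply_apply]
        exact Γ.top_mem⟩
      bot_notMem := by
        rw [mem_ofPred_eq, map_bot]
        exact Γ.isClan.bot_notMem
      mem_of_le := fun F G hF hFG => Γ.isClan.mem_of_le _ _ hF (ψ.symm.monotone hFG)
      sup_mem := fun F G hFG => by
        rw [mem_ofPred_eq, map_sup] at hFG
        exact Γ.isClan.sup_mem _ _ hFG
      sharp := fun F G hF hG => by
        have h := (S.sharpRel_iff ψ hψ _ _).1 (Γ.isClan.sharp _ _ hF hG)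
        rwa [OrderIso.apply_symm_apply, OrderIso.apply_symm_apply] at h }
  refine ⟨x, SetLike.ext fun a => ?_⟩
  have h : ψ.symm (ψ a) ∈ Γ ↔ x ∈ clX (ψ a) := Set.ext_iff.1 hx (ψ a)
  rw [OrderIso.symm_apply_apply] at h
  exact h.symm

theorem isUlt_toClan (x : S.X₀) : IsUlt (S.toClan ψ hψ x : Set A) where
  top_mem := (S.toClan ψ hψ x).top_mem
  bot_notMem := (S.toClan ψ hψ x).isClan.bot_notMem
  mem_of_le := (S.toClan ψ hψ x).isClan.mem_of_le
  inf_mem a b ha hb := by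
    change (x : S.X) ∈ clX (ψ (a ⊓ b))
    rw [coe_mem_clX, map_inf]
    exact ⟨coe_mem_clX.1 ha, coe_mem_clX.1 hb⟩
  mem_or_compl_mem a := by
    change (x : S.X) ∈ clX (ψ a) ∨ (x : S.X) ∈ clX (ψ aᶜ)
    rw [coe_mem_clX, coe_mem_clX, map_compl]
    exact em _

/-- Ultrafilters of `A` come from points of `X₀`, as `X₀` is compact. -/
theorem exists_toClan_eq_of_isUlt {Γ : Clan A} (hΓ : IsUlt (Γ : Set A)) :
    ∃ x : S.X₀, S.toClan ψ hψ x = Γ := by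
  have := S.stone.compact
  have : Nonempty {a : A // a ∈ Γ} := ⟨⟨⊤, Γ.top_mem⟩⟩
  obtain ⟨x, hx⟩ := IsCompact.nonempty_iInter_of_directed_nonempty_isCompact_isClosed
    (fun a : {a : A // a ∈ Γ} => (ψ a.1 : Set S.X₀))
    (fun a b => ⟨⟨a.1 ⊓ b.1, hΓ.inf_mem _ _ a.2 b.2⟩,
      ψ.monotone inf_le_left, ψ.monotone inf_le_right⟩)
    (fun a => by
      rw [nonempty_iff_ne_empty]
      intro h
      have h0 : ψ a.1 = ⊥ := SetLike.coe_injective h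
      rw [map_eq_bot_iff] at h0
      exact Γ.isClan.bot_notMem (h0 ▸ a.2))
    (fun a => (ψ a.1).isClosed.isCompact) (fun a => (ψ a.1).isClosed)
  refine ⟨x, SetLike.coe_injective (IsUlt.eq_of_subset hΓ (isUlt_toClan x) fun a ha => ?_).symm⟩
  exact coe_mem_clX.2 (mem_iInter.1 hx ⟨a, ha⟩)

/-- A closed relation on a zero-dimensional space is determined by its clopen neighbourhoods. -/
theorem rel_iff_forall_clopen {x y : S.X₀} :
    S.R x y ↔ ∀ F G : Clopens S.X₀, x ∈ F → y ∈ G → clopenRel S.R F G := by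
  refine ⟨fun h F G hx hy => ⟨x, hx, y, hy, h⟩, fun h => ?_⟩
  by_contra hn
  obtain ⟨U, V, hU, hV, hxU, hyV, hUV⟩ :=
    isOpen_prod_iff.1 S.stone.isClosed_rel.isOpen_compl x y hn
  obtain ⟨F, hF, hxF, hFU⟩ := S.stone.zeroDim.exists_subset_of_mem_open hxU hU
  obtain ⟨G, hG, hyG, hGV⟩ := S.stone.zeroDim.exists_subset_of_mem_open hyV hV
  obtain ⟨p, hp, q, hq, hpq⟩ := h ⟨F, hF⟩ ⟨G, hG⟩ hxF hyG
  exact hUV (mk_mem_prod (hFU hp) (hGV hq)) hpq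

/-- A 2-precontact space is isomorphic to the canonical space of every precontact algebra that
is isomorphic to its algebra of clopen sets `(CO(X₀), C_R)`. -/
theorem nonempty_iso_canonicalSpace (S : TwoPrecontactSpace.{u}) {A : PrecontactAlgebra.{u}}
    (ψ : A ≃o Clopens S.X₀) (hψ : ∀ a b : A, A.C a b ↔ clopenRel S.R (ψ a) (ψ b)) :
    Nonempty (Iso S A.canonicalSpace) := by
  refine ⟨⟨(Equiv.ofBijective _ (bijective_toClan (hψ := hψ))).toHomeomorphOfIsInducing
    (isInducing_toClan (hψ := hψ)), ?_, fun x y => ?_⟩⟩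
  · ext Γ
    constructor
    · rintro ⟨x, hx, rfl⟩
      exact isUlt_toClan (hψ := hψ) ⟨x, hx⟩
    · intro hΓ
      obtain ⟨x, rfl⟩ := exists_toClan_eq_of_isUlt (hψ := hψ) hΓ
      exact ⟨x, x.2, rfl⟩
  · rw [rel_iff_forall_clopen]
    constructor
    · intro h a ha b hb
      exact (hψ a b).2 (h _ _ (coe_mem_clX.1 ha) (coe_mem_clX.1 hb))
    · intro h F G hx hy
      have h1 := (hψ _ _).1 (h (ψ.symm F)
        (show (x : S.X) ∈ clX (ψ (ψ.symm F)) by rwa [OrderIso.apply_symm_apply, coe_mem_clX])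
        (ψ.symm G)
        (show (y : S.X) ∈ clX (ψ (ψ.symm G)) by rwa [OrderIso.apply_symm_apply, coe_mem_clX]))
      rwa [OrderIso.apply_symm_apply, OrderIso.apply_symm_apply] at h1

end Reconstruction

theorem nonempty_iso_canonicalSpace_of_iso (S : TwoPrecontactSpace.{u})
    {A : PrecontactAlgebra.{u}} (φ : PrecontactAlgebra.Iso A S.canonicalAlgebra) :
    Nonempty (Iso S A.canonicalSpace) :=
  S.nonempty_iso_canonicalSpace
    (OrderIso.trans (β := rcPair S.X₀ S.dense) φ.toOrderIso (clopensIso S.dense).symm)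
    fun a b => (φ.map_rel a b).trans (S.canonicalAlgebra_C_iff _ _)

/-! ### The correspondence of isomorphism classes -/

/-- The homeomorphism of the dense parts induced by a PCS-isomorphism. -/
def Iso.homeomorphDense {S T : TwoPrecontactSpace.{u}} (f : Iso S T) : S.X₀ ≃ₜ T.X₀ :=
  (f.toHomeomorph.image S.X₀).trans (Homeomorph.setCongr f.image_eq)

/-- The isomorphism of the algebras of clopen sets induced by a PCS-isomorphism. -/
def Iso.clopensCongr {S T : TwoPrecontactSpace.{u}} (f : Iso S T) :
    Clopens S.X₀ ≃o Clopens T.X₀ where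
  toFun F := ⟨f.homeomorphDense.symm ⁻¹' F, F.isClopen.preimage f.homeomorphDense.symm.continuous⟩
  invFun G := ⟨f.homeomorphDense ⁻¹' G, G.isClopen.preimage f.homeomorphDense.continuous⟩
  left_inv F := SetLike.coe_injective (f.homeomorphDense.toEquiv.preimage_symm_preimage F)
  right_inv G := SetLike.coe_injective (f.homeomorphDense.symm.toEquiv.preimage_symm_preimage G)
  map_rel_iff' {F G} := f.homeomorphDense.symm.surjective.preimage_subset_preimage_iff
    (s := (F : Set S.X₀)) (t := G)

theorem Iso.clopenRel_clopensCongr {S T : TwoPrecontactSpace.{u}} (f : Iso S T)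
    (F G : Clopens S.X₀) :
    clopenRel S.R F G ↔ clopenRel T.R (f.clopensCongr F) (f.clopensCongr G) := by
  have hmem : ∀ (H : Clopens S.X₀) (x : S.X₀), f.homeomorphDense x ∈ f.clopensCongr H ↔ x ∈ H := by
    intro H x
    change f.homeomorphDense.symm (f.homeomorphDense x) ∈ H ↔ x ∈ H
    rw [Homeomorph.symm_apply_apply]
  constructor
  · rintro ⟨x, hx, y, hy, h⟩
    exact ⟨_, (hmem F x).2 hx, _, (hmem G y).2 hy, (f.map_rel x y).1 h⟩
  · rintro ⟨x, hx, y, hy, h⟩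
    obtain ⟨x, rfl⟩ := f.homeomorphDense.surjective x
    obtain ⟨y, rfl⟩ := f.homeomorphDense.surjective y
    exact ⟨x, (hmem F x).1 hx, y, (hmem G y).1 hy, (f.map_rel x y).2 h⟩

/-- The isomorphism of canonical algebras induced by a PCS-isomorphism. -/
noncomputable def Iso.canonicalAlgebra {S T : TwoPrecontactSpace.{u}} (f : Iso S T) :
    PrecontactAlgebra.Iso S.canonicalAlgebra T.canonicalAlgebra where
  toOrderIso := ((clopensIso S.dense).symm.trans f.clopensCongr).trans (clopensIso T.dense)
  map_rel F G := ((S.canonicalAlgebra_C_iff F G).trans (f.clopenRel_clopensCongr _ _)).trans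
    (T.canonicalAlgebra_C_clopensIso _ _).symm

theorem isConnected_congr {S T : TwoPrecontactSpace.{u}} (f : Iso S T) :
    S.IsConnected ↔ T.IsConnected :=
  ⟨fun (_ : PreconnectedSpace S.X) =>
      f.toHomeomorph.surjective.denseRange.preconnectedSpace f.toHomeomorph.continuous,
    fun (_ : PreconnectedSpace T.X) =>
      f.toHomeomorph.symm.surjective.denseRange.preconnectedSpace
        f.toHomeomorph.symm.continuous⟩

theorem nonempty_X₀_congr {S T : TwoPrecontactSpace.{u}} (f : Iso S T) :
    S.X₀.Nonempty ↔ T.X₀.Nonempty := by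
  rw [← f.image_eq, image_nonempty]

end TwoPrecontactSpace

/-- The bijection `[B] ↦ [X(B)]` between isomorphism classes, with inverse `[S] ↦ [B(S)]`. -/
noncomputable def classesEquiv :
    Quotient PrecontactAlgebra.setoid.{u} ≃ Quotient TwoPrecontactSpace.setoid.{u} where
  toFun := Quotient.map PrecontactAlgebra.canonicalSpace fun A B ⟨φ⟩ => by
    -- `A` represents the space of `B`, since `A ≅ B ≅ B(X(B))`.
    obtain ⟨χ⟩ := PrecontactAlgebra.setoid.trans ⟨φ⟩ ⟨B.isoCanonicalAlgebra⟩
    exact TwoPrecontactSpace.setoid.symm (B.canonicalSpace.nonempty_iso_canonicalSpace_of_iso χ)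
  invFun := Quotient.map TwoPrecontactSpace.canonicalAlgebra fun _ _ ⟨f⟩ => ⟨f.canonicalAlgebra⟩
  left_inv := by
    rintro ⟨B⟩
    exact Quotient.sound (PrecontactAlgebra.setoid.symm ⟨B.isoCanonicalAlgebra⟩)
  right_inv := by
    rintro ⟨S⟩
    obtain ⟨χ⟩ := PrecontactAlgebra.setoid.refl S.canonicalAlgebra
    exact Quotient.sound
      (TwoPrecontactSpace.setoid.symm (S.nonempty_iso_canonicalSpace_of_iso χ))

/-- The correspondence restricts to classes cut out by matching properties, provided that the
property of spaces is invariant under isomorphism. -/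
theorem classesEquiv_bijOn {P : PrecontactAlgebra.{u} → Prop} {Q : TwoPrecontactSpace.{u} → Prop}
    (hPQ : ∀ B, P B ↔ Q B.canonicalSpace)
    (hQ : ∀ {S T : TwoPrecontactSpace.{u}}, TwoPrecontactSpace.Iso S T → (Q S ↔ Q T)) :
    Set.BijOn classesEquiv {c | ∃ B : PrecontactAlgebra.{u}, P B ∧ c = ⟦B⟧}
      {d | ∃ S : TwoPrecontactSpace.{u}, Q S ∧ d = ⟦S⟧} := by
  refine ⟨?_, classesEquiv.injective.injOn, ?_⟩
  · rintro _ ⟨B, hB, rfl⟩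
    exact ⟨B.canonicalSpace, (hPQ B).1 hB, rfl⟩
  · rintro _ ⟨S, hS, rfl⟩
    have h : classesEquiv ⟦S.canonicalAlgebra⟧ = ⟦S⟧ := classesEquiv.right_inv ⟦S⟧
    obtain ⟨f⟩ := Quotient.exact h
    exact ⟨_, ⟨S.canonicalAlgebra, (hPQ _).2 ((hQ f).2 hS), rfl⟩, h⟩

end Precontact

theorem theorem6p1 :
    (∀ B : PrecontactAlgebra.{u},
      (∃ φ : PrecontactAlgebra.Iso B B.canonicalSpace.canonicalAlgebra,
        ∀ a : B, B.canonicalSpace.region (φ.toOrderIso a) = Clan.g a) ∧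
      (B.sharp.IsContact ∧ B.canonicalSpace.contactAlgebra.IsContact ∧
        ∃ ψ : PrecontactAlgebra.Iso B.sharp B.canonicalSpace.contactAlgebra,
          ∀ a : B, B.canonicalSpace.region (ψ.toOrderIso a) = Clan.g a) ∧
      ({F : Set B.canonicalSpace.X | closure (interior F) = F} = rcPairSet B.canonicalSpace.X₀ ↔
        B.IsComplete) ∧
      (AxRef B.C ↔ B.canonicalSpace.IsReflexive) ∧
      (AxSym B.C ↔ B.canonicalSpace.IsSymmetric) ∧
      (AxTr B.C ↔ B.canonicalSpace.IsTransitive) ∧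
      (B.IsConnected ↔ B.canonicalSpace.IsConnected) ∧
      (Nontrivial B ↔ B.canonicalSpace.X₀.Nonempty)) ∧
    ∃ Φ : Quotient PrecontactAlgebra.setoid.{u} ≃ Quotient TwoPrecontactSpace.setoid.{u},
      (∀ B : PrecontactAlgebra.{u}, Φ ⟦B⟧ = ⟦B.canonicalSpace⟧) ∧
      (∀ S : TwoPrecontactSpace.{u}, Φ.symm ⟦S⟧ = ⟦S.canonicalAlgebra⟧) ∧
      Set.BijOn Φ {c | ∃ B : PrecontactAlgebra.{u}, B.IsConnected ∧ c = ⟦B⟧}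
        {d | ∃ S : TwoPrecontactSpace.{u}, S.IsConnected ∧ d = ⟦S⟧} ∧
      Set.BijOn Φ {c | ∃ B : PrecontactAlgebra.{u}, Nontrivial B ∧ c = ⟦B⟧}
        {d | ∃ S : TwoPrecontactSpace.{u}, S.X₀.Nonempty ∧ d = ⟦S⟧} := by
  refine ⟨fun B => ⟨⟨B.isoCanonicalAlgebra, B.coe_gIso⟩,
    ⟨B.sharp_isContact, B.canonicalSpace.contactAlgebra_isContact, B.isoContactAlgebra,
      B.coe_gIso⟩,
    B.regularClosed_eq_rcPairSet_iff, B.axRef_iff, B.axSym_iff, B.axTr_iff, B.isConnected_iff,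
    B.nontrivial_iff⟩, classesEquiv, fun _ => rfl, fun _ => rfl, ?_, ?_⟩
  · exact classesEquiv_bijOn (fun B => B.isConnected_iff)
      fun f => TwoPrecontactSpace.isConnected_congr f
  · exact classesEquiv_bijOn (P := fun B => Nontrivial B) (Q := fun S => S.X₀.Nonempty)
      (fun B => B.nontrivial_iff) fun f => TwoPrecontactSpace.nonempty_X₀_congr f
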